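/- For a connected finite simple graph $H$ with graph distance $\mathrm{dist}_H$, let $R(H)$ be the set of positive distances realized between vertices of $H$. For $D \subseteq R(H)$ let $G(H,D)$ be the graph on $V(H)$ in which $u$ and $v$ are adjacent if and only if $\mathrm{dist}_H(u,v) \in D$. For a positive integer $k \le |R(H)|$, the $k$-th Babai number of $H$ is $$B_k(H) = \sup\{\chi(G(H,D)) : D \subseteq R(H),\ |D| = k\},$$ where $\chi$ denotes the chromatic number. Theorem. Let $n \ge 4$ be an integer and let $C_n$ be the cycle on $n$ vertices. Then $$B_2(C_n)=\begin{cases} 3, & \text{if } n=3^u \text{ or } n=2\cdot 3^u \text{ for some integer } u\ge 1;\\ 4, & \text{if } n \text{ is not of the form } 3^u \text{ or } 2\cdot 3^u \text{ with an integer } u \ge 1, \text{ and } 5\nmid n;\\ 5, & \text{if } 5 \mid n. \end{cases}$$ -/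

import Mathlib

namespace SimpleGraph

variable {V : Type*}

/-- The distance graph `G(H, D)` of the graph metric of `H`: it has the vertices of `H`, and two
of them are adjacent iff their distance in `H` is positive and belongs to `D`. (Mathlib's `dist`
is `0` on pairs that no walk joins, so such pairs are never adjacent here.) -/
def distanceGraph (H : SimpleGraph V) (D : Set ℕ) : SimpleGraph V where
  Adj u v := H.dist u v ≠ 0 ∧ H.dist u v ∈ D
  symm := ⟨fun u v h => by rwa [H.dist_comm (u := v) (v := u)]⟩
  loopless := ⟨fun v h => h.1 (H.dist_self (v := v))⟩

/-- The set `R(H)` of the positive distances that are realized between vertices of `H`. -/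
def realizedDistances (H : SimpleGraph V) : Set ℕ :=
  {d | d ≠ 0 ∧ ∃ u v : V, H.dist u v = d}

/-- The `k`-th Babai number `B_k(H)`: the supremum of the chromatic numbers of the distance graphs
`G(H, D)` over all sets `D` of exactly `k` realized positive distances. -/
noncomputable def babaiNumber (k : ℕ) (H : SimpleGraph V) : ℕ∞ :=
  sSup {c : ℕ∞ | ∃ D : Finset ℕ, (D : Set ℕ) ⊆ H.realizedDistances ∧ D.card = k ∧
    c = (H.distanceGraph (D : Set ℕ)).chromaticNumber}

end SimpleGraph

/-! Upper bounds: distances `d`, `e` in the cycle are jumps `±d`, `±e` in `ZMod n`, so the distance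
graph maps to a circulant graph of degree at most 4, and greedy coloring gives 5 colors. Four colors
suffice when `5 ∤ n`, in the spirit of Brooks: on the subgroup generated by the jumps the only
obstruction is `K₅`, which needs a subgroup of order 5 (`circulantGraph_pair_colorable_four`). When
`n ∣ 2 * 3 ^ u`, every jump has order divisible by 3 or is killed by 2, and explicit colorings use 3
colors (`circulantGraph_pair_colorable_three`).

Lower bounds: the multiples of `n / 5` form a `K₅` and those of `n / 3` a triangle. If `n = d * w`
with `d` a power of 3, `3 ∤ w` and `w ≥ 4`, the jumps `d`, `2 * d` produce the square of a
`w`-cycle, whose 3-colorings would have period 3 and cannot close up. The values `w = 1, 2` are the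
exceptional `n`. -/

namespace SimpleGraph

/-! ### Greedy coloring and a Brooks-type criterion -/

variable {V : Type*} {G : SimpleGraph V} {k : ℕ}

/-- The function `f` gives different colors to adjacent vertices of `T`. -/
def ProperOn (G : SimpleGraph V) (T : Set V) (f : V → Fin k) : Prop :=
  ∀ u ∈ T, ∀ v ∈ T, G.Adj u v → f u ≠ f v

theorem exists_color_notMem_image (f : V → Fin k) {S : Finset V} (hS : S.card < k) :
    ∃ c, ∀ w ∈ S, f w ≠ c := by
  classical
  have h : (S.image f).card < (Finset.univ : Finset (Fin k)).card := by
    simpa using Finset.card_image_le.trans_lt hS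
  obtain ⟨c, -, hc⟩ := Finset.exists_mem_notMem_of_card_lt_card h
  exact ⟨c, fun w hw e => hc (Finset.mem_image.2 ⟨w, hw, e⟩)⟩

theorem ProperOn.update [DecidableEq V] {T T' : Set V} {f : V → Fin k} (hf : G.ProperOn T f)
    {v : V} {c : Fin k} (hT : ∀ w ∈ T', w ≠ v → w ∈ T) (hc : ∀ w ∈ T', G.Adj v w → f w ≠ c) :
    G.ProperOn T' (Function.update f v c) := by
  intro u hu w hw huw
  by_cases h1 : u = v
  · subst h1
    have h2 : w ≠ u := huw.ne'
    simpa [Function.update_of_ne h2] using (hc w hw huw).symm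
  · by_cases h2 : w = v
    · subst h2
      simpa [Function.update_of_ne h1] using hc u hu huw.symm
    · simpa [Function.update_of_ne h1, Function.update_of_ne h2] using
        hf u (hT u hu h1) w (hT w hw h2) huw

theorem ProperOn.colorable {f : V → Fin k} (hf : G.ProperOn Set.univ f) : G.Colorable k :=
  ⟨Coloring.mk f fun {u v} h => hf u trivial v trivial h⟩

/-- Greedy coloring: a finite graph all of whose vertices have fewer than `k` neighbors is
`k`-colorable. -/
theorem colorable_of_card_neighbors_lt [Finite V] (N : V → Finset V)
    (hN : ∀ v w, G.Adj v w → w ∈ N v) (hk : ∀ v, (N v).card < k) : G.Colorable k := by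
  classical
  have := Fintype.ofFinite V
  rcases isEmpty_or_nonempty V with hV | ⟨⟨v₀⟩⟩
  · exact Colorable.of_isEmpty k
  have h : ∀ T : Finset V, ∃ f : V → Fin k, G.ProperOn (T : Set V) f := by
    intro T
    induction T using Finset.induction_on with
    | empty =>
      exact ⟨fun _ => ⟨0, (Nat.zero_le _).trans_lt (hk v₀)⟩, fun u hu => by simp at hu⟩
    | insert v T _ ih =>
      obtain ⟨f, hf⟩ := ih
      obtain ⟨c, hc⟩ := exists_color_notMem_image f (hk v)
      refine ⟨Function.update f v c, hf.update (fun w hw hne => ?_) fun w _ hw => hc w (hN v w hw)⟩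
      simpa [hne] using hw
  obtain ⟨f, hf⟩ := h Finset.univ
  exact ProperOn.colorable (f := f) (by simpa using hf)

/-- Brooks-type criterion: let every vertex have at most `k` neighbors, and let `x`, `y` be two
non-adjacent neighbors of `z` whose removal leaves a connected graph. Then the graph is
`k`-colorable. -/
theorem colorable_of_connected_compl_pair [Finite V] (N : V → Finset V)
    (hN : ∀ v w, G.Adj v w → w ∈ N v) (hk : ∀ v, (N v).card ≤ k) {x y z : V} (hxy : ¬ G.Adj x y)
    (hne : x ≠ y) (hzx : G.Adj z x) (hzy : G.Adj z y)
    (hconn : ∀ R : Set V, z ∈ R → (∀ u ∈ R, ∀ v, G.Adj u v → v ≠ x → v ≠ y → v ∈ R) →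
      ∀ v, v ≠ x → v ≠ y → v ∈ R) : G.Colorable k := by
  classical
  -- `R` is a still uncolored region around `z`: every coloring outside `R` that agrees on `x` and
  -- `y` can be completed. It starts at `{z}`, where `x` and `y` block only one color together, and
  -- grows along edges, since a vertex with an uncolored neighbor has a free color. A maximal `R`
  -- leaves only `x` and `y`.
  let P : Set V → Prop := fun R => z ∈ R ∧ x ∉ R ∧ y ∉ R ∧
    ∀ f : V → Fin k, G.ProperOn Rᶜ f → f x = f y → G.Colorable k
  have free : ∀ (f : V → Fin k) (v u : V), G.Adj v u →
      ∃ c, ∀ w, G.Adj v w → w ≠ u → f w ≠ c := by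
    intro f v u hvu
    have hlt : ((N v).erase u).card < k :=
      (Finset.card_erase_lt_of_mem (hN v u hvu)).trans_le (hk v)
    obtain ⟨c, hc⟩ := exists_color_notMem_image f hlt
    exact ⟨c, fun w hw hwu => hc w (Finset.mem_erase.2 ⟨hwu, hN v w hw⟩)⟩
  have hbase : P {z} := by
    refine ⟨rfl, hzx.ne', hzy.ne', fun f hf hfxy => ?_⟩
    obtain ⟨c, hc⟩ := free f z x hzx
    refine (hf.update (T' := Set.univ) (v := z) (c := c) (fun w _ h => h) ?_).colorable
    intro w _ hw
    by_cases hwx : w = x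
    · rw [hwx, hfxy]
      exact hc y hzy hne.symm
    · exact hc w hw hwx
  have hstep : ∀ R u v, P R → u ∈ R → G.Adj u v → v ≠ x → v ≠ y → P (insert v R) := by
    rintro R u v ⟨h1, h2, h3, h4⟩ hu huv hvx hvy
    refine ⟨Or.inr h1, by simp [h2, hvx.symm], by simp [h3, hvy.symm], fun f hf hfxy => ?_⟩
    obtain ⟨c, hc⟩ := free f v u huv.symm
    refine h4 (Function.update f v c) (hf.update ?_ ?_) ?_
    · intro w hw hwv
      simpa [hwv] using hw
    · intro w hw hvw
      refine hc w hvw ?_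
      rintro rfl
      exact hw hu
    · rwa [Function.update_of_ne hvx.symm, Function.update_of_ne hvy.symm]
  obtain ⟨R, hR⟩ := (Set.toFinite {R | P R}).exists_maximal ⟨_, hbase⟩
  obtain ⟨h1, h2, h3, h4⟩ := hR.prop
  have hall := hconn R h1 fun u hu v huv hvx hvy =>
    hR.le_of_ge (hstep R u v hR.prop hu huv hvx hvy) (Set.subset_insert v R) (Set.mem_insert v R)
  have hpos : 0 < k := (Finset.card_pos.2 ⟨x, hN z x hzx⟩).trans_le (hk z)
  refine h4 (fun _ => ⟨0, hpos⟩) (fun u hu v hv huv _ => ?_) rfl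
  have key : ∀ w ∈ Rᶜ, w = x ∨ w = y := fun w hw => by
    by_contra! h
    exact hw (hall w h.1 h.2)
  rcases key u hu with rfl | rfl <;> rcases key v hv with rfl | rfl
  · exact G.loopless.irrefl _ huv
  · exact hxy huv
  · exact hxy huv.symm
  · exact G.loopless.irrefl _ huv

end SimpleGraph

/-! ### Coloring tools for circulant graphs with two jumps -/

namespace SimpleGraph

variable {A : Type*} [AddCommGroup A] {a b : A} {k : ℕ}

theorem circulantGraph_pair_adj {u v : A} : (circulantGraph {a, b}).Adj u v ↔
    u ≠ v ∧ (v = u + a ∨ v = u - a ∨ v = u + b ∨ v = u - b) := by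
  have h1 : u - v = a ↔ v = u - a := ⟨fun h => by rw [← h]; abel, fun h => by rw [h]; abel⟩
  have h2 : u - v = b ↔ v = u - b := ⟨fun h => by rw [← h]; abel, fun h => by rw [h]; abel⟩
  simp only [circulantGraph_adj, Set.mem_insert_iff, Set.mem_singleton_iff, h1, h2,
    sub_eq_iff_eq_add']
  tauto

theorem colorable_circulantGraph_pair {C : Type*} [Fintype C] (f : A → C)
    (ha : ∀ x, f (x + a) ≠ f x) (hb : ∀ x, f (x + b) ≠ f x) :
    (circulantGraph {a, b}).Colorable (Fintype.card C) := by
  refine (Coloring.mk f ?_ : (circulantGraph {a, b}).Coloring C).colorable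
  intro u v h
  obtain ⟨-, rfl | rfl | rfl | rfl⟩ := circulantGraph_pair_adj.1 h
  · exact (ha u).symm
  · simpa using ha (u - a)
  · exact (hb u).symm
  · simpa using hb (u - b)

/-- A circulant graph may be colored coset by coset. -/
theorem colorable_circulantGraph_of_closure
    (h : (circulantGraph
      {(⟨a, AddSubgroup.subset_closure (by simp)⟩ : AddSubgroup.closure ({a, b} : Set A)),
       ⟨b, AddSubgroup.subset_closure (by simp)⟩}).Colorable k) :
    (circulantGraph {a, b}).Colorable k := by
  set H := AddSubgroup.closure ({a, b} : Set A) with hH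
  have haH : a ∈ H := AddSubgroup.subset_closure (by simp)
  have hbH : b ∈ H := AddSubgroup.subset_closure (by simp)
  -- `r` picks a representative of each coset of `H`; subtracting it moves every coset onto `H` and
  -- preserves the jumps.
  let r : A → A := fun x => (QuotientAddGroup.mk x : A ⧸ H).out
  have hr : ∀ x, x - r x ∈ H := fun x => by
    have : (QuotientAddGroup.mk (r x) : A ⧸ H) = QuotientAddGroup.mk x := Quotient.out_eq _
    rw [QuotientAddGroup.eq] at this
    rwa [sub_eq_neg_add]
  have hadd : ∀ x y, y ∈ H → r (x + y) = r x := fun x y hy => by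
    have : (QuotientAddGroup.mk (x + y) : A ⧸ H) = QuotientAddGroup.mk x :=
      QuotientAddGroup.mk_add_of_mem x hy
    simp only [r, this]
  refine h.of_hom (⟨fun x => ⟨x - r x, hr x⟩, ?_⟩ : circulantGraph {a, b} →g _)
  intro u v huv
  rw [circulantGraph_pair_adj] at huv ⊢
  obtain ⟨hne, huv⟩ := huv
  have hruv : r v = r u := by
    rcases huv with rfl | rfl | rfl | rfl
    · exact hadd u a haH
    · rw [sub_eq_add_neg]; exact hadd u _ (neg_mem haH)
    · exact hadd u b hbH
    · rw [sub_eq_add_neg]; exact hadd u _ (neg_mem hbH)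
  refine ⟨fun e => hne ?_, ?_⟩
  · have := congrArg Subtype.val e
    simpa [hruv] using this
  · simp only [Subtype.ext_iff, AddSubgroup.coe_add, AddSubgroup.coe_sub, hruv]
    rcases huv with rfl | rfl | rfl | rfl
    · left; abel
    · right; left; abel
    · right; right; left; abel
    · right; right; right; abel

theorem exists_zsmul_add_zsmul_eq_of_closure
    (v : AddSubgroup.closure ({a, b} : Set A)) : ∃ i j : ℤ,
      i • (⟨a, AddSubgroup.subset_closure (by simp)⟩ : AddSubgroup.closure ({a, b} : Set A)) +
      j • ⟨b, AddSubgroup.subset_closure (by simp)⟩ = v := by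
  obtain ⟨i, j, h⟩ := AddSubgroup.mem_closure_pair.1 v.2
  exact ⟨i, j, Subtype.ext h⟩

/-- If `3` divides the order of `b` and `a` is not a multiple of `b`, a `3`-coloring may be chosen
that increases by `1` along `b`. -/
theorem circulantGraph_colorable_three_of_dvd_addOrderOf [Finite A]
    (hgen : ∀ v : A, ∃ i j : ℤ, i • a + j • b = v) (h3 : 3 ∣ addOrderOf b)
    (hab : a ∉ AddSubgroup.zmultiples b) : (circulantGraph {a, b}).Colorable 3 := by
  let q : ℕ := addOrderOf (a : A ⧸ AddSubgroup.zmultiples b)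
  have hq : ∀ i : ℤ, i • a ∈ AddSubgroup.zmultiples b ↔ (q : ℤ) ∣ i := fun i => by
    rw [addOrderOf_dvd_iff_zsmul_eq_zero, ← QuotientAddGroup.mk_zsmul,
      QuotientAddGroup.eq_zero_iff]
  have hq0 : 0 < q := addOrderOf_pos _
  have hq1 : q ≠ 1 := fun h => hab (by simpa [h] using hq 1)
  have hq2 : 2 ≤ q := by omega
  obtain ⟨t, ht⟩ := AddSubgroup.mem_zmultiples_iff.1 ((hq q).2 dvd_rfl)
  have hb : ∀ i : ℤ, i • b = 0 → ((i : ℤ) : ZMod 3) = 0 := fun i hi => by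
    rw [ZMod.intCast_zmod_eq_zero_iff_dvd]
    exact (Int.natCast_dvd_natCast.2 h3).trans (addOrderOf_dvd_iff_zsmul_eq_zero.2 hi)
  let alt : ℤ → ZMod 3 := fun r => if r % 2 = 0 then 0 else 1
  have halt : ∀ r, alt (r + 1) ≠ alt r := fun r => by
    simp only [alt]
    rcases Int.emod_two_eq_zero_or_one r with h | h
    · rw [if_neg (by omega), if_pos h]; decide
    · rw [if_pos (by omega), if_neg (by omega)]; decide
  -- `c` colors the last column of a block of `q` columns. It must differ from the column before it
  -- and from the first column of the next block, which is shifted by `t` because `q • a = t • b`.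
  obtain ⟨c, hc1, hc2⟩ : ∃ c : ZMod 3, c ≠ alt (q - 2) ∧ c ≠ t := by
    generalize alt (q - 2) = x
    generalize (t : ZMod 3) = y
    revert x y
    decide
  let g : ℤ → ZMod 3 := fun r => if r = q - 1 then c else alt r
  -- The color of `i • a + j • b`; it does not depend on the representation because `3 ∣ addOrderOf
  -- b`.
  let F : ℤ → ℤ → ZMod 3 := fun i j => (j : ZMod 3) + t * (i / q : ℤ) + g (i % q)
  have hF : ∀ i j i' j' : ℤ, i • a + j • b = i' • a + j' • b → F i j = F i' j' := by
    intro i j i' j' h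
    have e1 : (i - i') • a = (j' - j) • b := by
      rw [sub_smul, sub_smul, sub_eq_sub_iff_add_eq_add, h, add_comm]
    obtain ⟨s, hs⟩ := (hq (i - i')).1 ⟨j' - j, e1.symm⟩
    obtain rfl : i = i' + q * s := by linarith
    have e2 : (s * t - (j' - j)) • b = 0 := by
      rw [sub_smul, ← e1, mul_smul, ht, hs, mul_comm, mul_smul, sub_self]
    have e3 := hb _ e2
    push_cast at e3
    simp only [F]
    rw [Int.add_mul_emod_self_left, Int.add_mul_ediv_left _ _ (by omega)]
    push_cast
    linear_combination e3
  have hF1 : ∀ i j, F i (j + 1) ≠ F i j := fun i j h => by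
    have : (1 : ZMod 3) = 0 := by
      simp only [F] at h
      push_cast at h
      linear_combination h
    exact absurd this (by decide)
  have hF2 : ∀ i j, F (i + 1) j ≠ F i j := fun i j h => by
    have hlt := Int.emod_lt_of_pos i (by omega : (0 : ℤ) < q)
    have hge := Int.emod_nonneg i (by omega : (q : ℤ) ≠ 0)
    have hdm := Int.mul_ediv_add_emod i q
    simp only [F] at h
    by_cases hr : i % q = q - 1
    · have e : i + 1 = 0 + q * (i / q + 1) := by linarith
      have e1 : (i + 1) % q = 0 := by rw [e, Int.add_mul_emod_self_left, Int.zero_emod]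
      have e2 : (i + 1) / q = i / q + 1 := by
        rw [e, Int.add_mul_ediv_left _ _ (by omega)]; simp
      have g0 : g 0 = 0 := by
        simp only [g, alt]
        rw [if_neg (by omega)]; simp
      have g1 : g (i % q) = c := by simp only [g]; rw [if_pos hr]
      rw [e1, e2, g0, g1] at h
      push_cast at h
      exact hc2 (by linear_combination -h)
    · have e : i + 1 = (i % q + 1) + q * (i / q) := by linarith
      have e1 : (i + 1) % q = i % q + 1 := by
        rw [e, Int.add_mul_emod_self_left, Int.emod_eq_of_lt (by omega) (by omega)]
      have e2 : (i + 1) / q = i / q := by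
        rw [e, Int.add_mul_ediv_left _ _ (by omega), Int.ediv_eq_zero_of_lt (by omega) (by omega)]
        simp
      rw [e1, e2] at h
      have h' : g (i % q + 1) = g (i % q) := by linear_combination h
      simp only [g] at h'
      rw [if_neg hr] at h'
      by_cases hr2 : i % q + 1 = q - 1
      · rw [if_pos hr2] at h'
        exact hc1 (by rw [h']; congr 1; omega)
      · rw [if_neg hr2] at h'
        exact halt _ h'
  choose I J hIJ using hgen
  have hval : ∀ i j, F (I (i • a + j • b)) (J (i • a + j • b)) = F i j :=
    fun i j => hF _ _ _ _ (hIJ _)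
  refine colorable_circulantGraph_pair (C := ZMod 3) (fun v => F (I v) (J v)) ?_ ?_
  · intro v
    obtain ⟨i, j, rfl⟩ : ∃ i j : ℤ, i • a + j • b = v := ⟨_, _, hIJ v⟩
    rw [show i • a + j • b + a = (i + 1) • a + j • b by rw [add_smul, one_smul]; abel]
    simpa only [hval] using hF2 i j
  · intro v
    obtain ⟨i, j, rfl⟩ : ∃ i j : ℤ, i • a + j • b = v := ⟨_, _, hIJ v⟩
    rw [show i • a + j • b + b = i • a + (j + 1) • b by rw [add_smul, one_smul]; abel]
    simpa only [hval] using hF1 i j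

theorem circulantGraph_pair_colorable_of_card_lt [Finite A] (S : Finset A) (hS : S.card < k)
    (h1 : a ∈ S) (h2 : -a ∈ S) (h3 : b ∈ S) (h4 : -b ∈ S) :
    (circulantGraph {a, b}).Colorable k := by
  classical
  refine colorable_of_card_neighbors_lt (fun v => S.image (v + ·)) ?_
    fun v => Finset.card_image_le.trans_lt hS
  intro v w h
  obtain ⟨-, rfl | rfl | rfl | rfl⟩ := circulantGraph_pair_adj.1 h <;>
    simp [sub_eq_add_neg, *]

theorem circulantGraph_pair_colorable_five [Finite A] : (circulantGraph {a, b}).Colorable 5 := by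
  classical
  exact circulantGraph_pair_colorable_of_card_lt {a, -a, b, -b} (Finset.card_le_four.trans_lt
    (by norm_num)) (by simp) (by simp) (by simp) (by simp)

/-- Removing `b` and `-b` from a circulant graph: a criterion for `4`-colorability. -/
theorem circulantGraph_pair_colorable_four_of_closed [Finite A] (hb : 2 • b ≠ 0) (hb3 : 3 • b ≠ 0)
    (h1 : 2 • b ≠ a) (h2 : 2 • b ≠ -a)
    (hconn : ∀ R : Set A, 0 ∈ R → (∀ u ∈ R, ∀ v, (circulantGraph {a, b}).Adj u v →
      v ≠ b → v ≠ -b → v ∈ R) → ∀ v, v ≠ b → v ≠ -b → v ∈ R) :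
    (circulantGraph {a, b}).Colorable 4 := by
  classical
  have hb0 : b ≠ 0 := by rintro rfl; simp at hb
  have hbb : b ≠ -b := fun h => hb (by rw [two_nsmul]; nth_rewrite 2 [h]; simp)
  refine colorable_of_connected_compl_pair (fun v => ({a, -a, b, -b} : Finset A).image (v + ·))
    ?_ (fun v => Finset.card_image_le.trans Finset.card_le_four) (x := b) (y := -b) (z := 0)
    ?_ hbb ?_ ?_ hconn
  · intro v w h
    obtain ⟨-, rfl | rfl | rfl | rfl⟩ := circulantGraph_pair_adj.1 h <;> simp [sub_eq_add_neg]
  -- `b` and `-b` differ by `2 • b`, which must avoid the four jumps.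
  · rw [circulantGraph_pair_adj]
    rintro ⟨-, h | h | h | h⟩
    · exact h2 (by rw [two_nsmul, eq_neg_iff_add_eq_zero, add_assoc, ← h]; simp)
    · exact h1 (by rw [two_nsmul, ← sub_eq_zero, add_sub_assoc, ← h]; simp)
    · exact hb3 (by rw [succ_nsmul, two_nsmul, add_assoc, ← h]; simp)
    · simp at h
      exact hb0 h
  · exact circulantGraph_pair_adj.2 ⟨hb0.symm, by simp⟩
  · exact circulantGraph_pair_adj.2 ⟨by simpa [eq_comm] using hb0, by simp⟩

/-- Deleting `b` and `-b` damages only the coset `⟨b⟩`. The other cosets stay connected along `b`,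
and each remaining element of `⟨b⟩` hangs on the coset of `-a` by an edge `a`. -/
theorem circulantGraph_pair_colorable_four_of_notMem [Finite A]
    (hgen : ∀ v : A, ∃ i j : ℤ, i • a + j • b = v)
    (hab : a ∉ AddSubgroup.zmultiples b) (hb : 2 • b ≠ 0) (hb3 : 3 • b ≠ 0) :
    (circulantGraph {a, b}).Colorable 4 := by
  have hb0 : b ≠ 0 := by rintro rfl; simp at hb
  refine circulantGraph_pair_colorable_four_of_closed hb hb3
    (fun h => hab ⟨2, (natCast_zsmul b 2).trans h⟩) (fun h => hab ⟨-2, ?_⟩) fun R h0 hR => ?_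
  · simp only [neg_smul]
    rw [eq_comm, ← neg_eq_iff_eq_neg, ← h]
    exact (natCast_zsmul b 2).symm
  have ha0 : a ≠ 0 := by
    rintro rfl
    exact hab (zero_mem _)
  have hbm : b ∈ AddSubgroup.zmultiples b := AddSubgroup.mem_zmultiples b
  have hout : ∀ v, v ∉ AddSubgroup.zmultiples b → v ≠ b ∧ v ≠ -b := fun v hv =>
    ⟨by rintro rfl; exact hv hbm, by rintro rfl; exact hv (neg_mem hbm)⟩
  have hnadj : ∀ u v, u ∈ R → v ≠ b → v ≠ -b →
      (v = u + a ∨ v = u - a ∨ v = u + b ∨ v = u - b) → v ∈ R := by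
    intro u v hu h1 h2 h
    refine hR u hu v (circulantGraph_pair_adj.2 ⟨?_, h⟩) h1 h2
    rintro rfl
    rcases h with h | h | h | h
    · exact ha0 (left_eq_add.1 h)
    · exact ha0 (sub_eq_self.1 h.symm)
    · exact hb0 (left_eq_add.1 h)
    · exact hb0 (sub_eq_self.1 h.symm)
  have hcoset : ∀ w, w ∉ AddSubgroup.zmultiples b → w ∈ R → ∀ j : ℤ, w + j • b ∈ R := by
    intro w hw hwR j
    have hw' : ∀ j : ℤ, w + j • b ∉ AddSubgroup.zmultiples b := fun j h =>
      hw (by simpa using sub_mem h (AddSubgroup.zsmul_mem _ hbm j))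
    induction j using Int.induction_on with
    | zero => simpa using hwR
    | succ i ih =>
      refine hnadj _ _ ih (hout _ (hw' _)).1 (hout _ (hw' _)).2 (Or.inr (Or.inr (Or.inl ?_)))
      rw [add_smul, one_smul, add_assoc]
    | pred i ih =>
      refine hnadj _ _ ih (hout _ (hw' _)).1 (hout _ (hw' _)).2 (Or.inr (Or.inr (Or.inr ?_)))
      rw [sub_smul, one_smul, add_sub_assoc]
  have hna : -a ∉ AddSubgroup.zmultiples b := fun h => hab (by simpa using neg_mem h)
  have haR : a ∈ R := hnadj 0 a h0 (hout _ hab).1 (hout _ hab).2 (by simp)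
  have hnaR : -a ∈ R := hnadj 0 (-a) h0 (hout _ hna).1 (hout _ hna).2 (by simp)
  have hzm : ∀ j : ℤ, j • b ≠ b → j • b ≠ -b → j • b ∈ R := fun j h1 h2 =>
    hnadj (-a + j • b) _ (hcoset _ hna hnaR j) h1 h2 (Or.inl (by abel))
  -- `Q` holds vacuously at the deleted vertices, so the induction on `i` can pass over them.
  let Q : A → Prop := fun v => v ≠ b → v ≠ -b → v ∈ R
  have hQa : ∀ v, (Q v → Q (v + a)) ∧ (Q v → Q (v - a)) := by
    intro v
    by_cases h1 : v = b
    · subst h1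
      exact ⟨fun _ _ _ => by simpa [add_comm] using hcoset _ hab haR 1,
        fun _ _ _ => by simpa [add_comm, sub_eq_add_neg] using hcoset _ hna hnaR 1⟩
    by_cases h2 : v = -b
    · subst h2
      exact ⟨fun _ _ _ => by simpa [add_comm] using hcoset _ hab haR (-1),
        fun _ _ _ => by simpa [add_comm, sub_eq_add_neg] using hcoset _ hna hnaR (-1)⟩
    exact ⟨fun h h3 h4 => hnadj v _ (h h1 h2) h3 h4 (by simp),
      fun h h3 h4 => hnadj v _ (h h1 h2) h3 h4 (by simp)⟩
  have hQ : ∀ i j : ℤ, Q (i • a + j • b) := by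
    intro i j
    induction i using Int.induction_on with
    | zero => simpa [Q] using hzm j
    | succ i ih =>
      have := (hQa _).1 ih
      rwa [show (i : ℤ) • a + j • b + a = ((i : ℤ) + 1) • a + j • b by
        rw [add_smul, one_smul]; abel] at this
    | pred i ih =>
      have := (hQa _).2 ih
      rwa [show (-(i : ℤ)) • a + j • b - a = (-(i : ℤ) - 1) • a + j • b by
        rw [sub_smul (-(i : ℤ)), one_smul]; abel] at this
  intro v
  obtain ⟨i, j, rfl⟩ := hgen v
  exact hQ i j

/-- Along the cycle of multiples of `b`, deleting `b` and `-b` leaves `0` and the path from `2 • b`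
to `(n - 2) • b`. Since `a = k • b` lies on that path, the jump `a` ties `0` to it. -/
theorem circulantGraph_pair_colorable_four_of_generator [Finite A]
    (hgen : ∀ v : A, v ∈ AddSubgroup.zmultiples b) (ha : a ≠ 0) (hab : a ≠ b) (hab' : a ≠ -b)
    (hb : 2 • b ≠ 0) (hb3 : 3 • b ≠ 0) (h1 : 2 • b ≠ a) (h2 : 2 • b ≠ -a) :
    (circulantGraph {a, b}).Colorable 4 := by
  refine circulantGraph_pair_colorable_four_of_closed hb hb3 h1 h2 fun R h0 hR => ?_
  have hb0 : b ≠ 0 := by rintro rfl; simp at hb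
  set n := addOrderOf b with hn
  have hnpos : 0 < n := addOrderOf_pos b
  have hex : ∀ v : A, ∃ i < n, i • b = v := fun v => by
    classical
    obtain ⟨i, hi, h⟩ := (mem_zmultiples_iff_mem_range_addOrderOf.1 (hgen v)
      |> Finset.mem_image.1)
    exact ⟨i, Finset.mem_range.1 hi, h⟩
  have hlast : (n - 1) • b = -b := by
    rw [eq_neg_iff_add_eq_zero, ← succ_nsmul, Nat.sub_add_cancel hnpos, addOrderOf_nsmul_eq_zero]
  have hinj : ∀ i j, i < n → j < n → i • b = j • b → i = j := fun i j hi hj h =>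
    nsmul_injOn_Iio_addOrderOf hi hj h
  have hmid : ∀ i, i < n → (i • b = b → i = 1) ∧ (i • b = -b → i = n - 1) := by
    intro i hi
    refine ⟨fun h => ?_, fun h => hinj i _ hi (by omega) (h.trans hlast.symm)⟩
    rcases Nat.lt_or_ge 1 n with h' | h'
    · exact hinj i 1 hi h' (by simpa using h)
    · obtain rfl : i = 0 := by omega
      exact absurd (by simpa using h.symm) hb0
  have hne : ∀ i, 2 ≤ i → i + 2 ≤ n → i • b ≠ b ∧ i • b ≠ -b := by
    intro i hi1 hi2
    refine ⟨fun h => ?_, fun h => ?_⟩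
    · have := (hmid i (by omega)).1 h
      omega
    · have := (hmid i (by omega)).2 h
      omega
  obtain ⟨k, hk, rfl⟩ := hex a
  have hk1 : 2 ≤ k := by
    by_contra! h
    interval_cases k <;> simp at ha hab
  have hk2 : k + 2 ≤ n := by
    by_contra! h
    obtain rfl : k = n - 1 := by omega
    exact hab' hlast
  have hstep : ∀ i, i • b ∈ R → 2 ≤ i + 1 → i + 1 + 2 ≤ n → (i + 1) • b ∈ R := by
    intro i hi h3 h4
    refine hR _ hi _ (circulantGraph_pair_adj.2 ⟨?_, ?_⟩) (hne _ h3 h4).1 (hne _ h3 h4).2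
    · rw [succ_nsmul]; simpa using hb0
    · rw [succ_nsmul]; simp
  have hstep' : ∀ i, (i + 1) • b ∈ R → 2 ≤ i → i + 2 ≤ n → i • b ∈ R := by
    intro i hi h3 h4
    refine hR _ hi _ (circulantGraph_pair_adj.2 ⟨?_, ?_⟩) (hne _ h3 h4).1 (hne _ h3 h4).2
    · rw [succ_nsmul]; simpa using hb0
    · rw [succ_nsmul]; simp
  have hkR : k • b ∈ R :=
    hR 0 h0 _ (circulantGraph_pair_adj.2 ⟨ha.symm, by simp⟩) (hne k hk1 hk2).1 (hne k hk1 hk2).2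
  have hup : ∀ j, k + j + 2 ≤ n → (k + j) • b ∈ R := by
    intro j
    induction j with
    | zero => intro _; simpa using hkR
    | succ j ih => intro h; exact hstep (k + j) (ih (by omega)) (by omega) (by omega)
  have hdown : ∀ j, 2 + j ≤ k → (k - j) • b ∈ R := by
    intro j
    induction j with
    | zero => intro _; simpa using hkR
    | succ j ih =>
      intro h
      refine hstep' _ ?_ (by omega) (by omega)
      rw [show k - (j + 1) + 1 = k - j by omega]
      exact ih (by omega)
  intro v hv1 hv2
  obtain ⟨i, hi, rfl⟩ := hex v
  rcases Nat.eq_zero_or_pos i with rfl | hi0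
  · simpa using h0
  have hi1 : i ≠ 1 := by rintro rfl; simp at hv1
  have hi2 : i ≠ n - 1 := by rintro rfl; exact hv2 hlast
  rcases le_total k i with h | h
  · have := hup (i - k) (by omega)
    rwa [Nat.add_sub_cancel' h] at this
  · have := hdown (k - i) (by omega)
    rwa [Nat.sub_sub_self h] at this

end SimpleGraph

/-! ### Four colors, and three colors for orders dividing `2 * 3 ^ u` -/

namespace SimpleGraph

variable {A : Type*} [AddCommGroup A] {a b : A}

theorem circulantGraph_pair_colorable_three_of_eq_neg [Finite A] (ha : a = -a) (hb : b = -b) :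
    (circulantGraph {a, b}).Colorable 3 := by
  classical
  exact circulantGraph_pair_colorable_of_card_lt {a, b} (Finset.card_le_two.trans_lt
    (by norm_num)) (by simp) (by simp [← ha]) (by simp) (by simp [← hb])

theorem circulantGraph_pair_colorable_four_of_eq_neg [Finite A] (hb : b = -b) :
    (circulantGraph {a, b}).Colorable 4 := by
  classical
  exact circulantGraph_pair_colorable_of_card_lt {a, -a, b} (Finset.card_le_three.trans_lt
    (by norm_num)) (by simp) (by simp) (by simp) (by simp [← hb])

theorem two_nsmul_eq_zero_iff_eq_neg : 2 • b = 0 ↔ b = -b := by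
  rw [two_nsmul, ← eq_neg_iff_add_eq_zero]

/-- Outside the low-degree and non-cyclic-generator cases both `a` and `b` generate. Deleting `±b`
then fails only if `a = ±2b`, and deleting `±a` only if `b = ±2a`; both together would give `3 • b =
0` or `5 • b = 0`. -/
theorem circulantGraph_pair_colorable_four_of_generates [Finite A]
    (hgen : ∀ v : A, ∃ i j : ℤ, i • a + j • b = v) (ha : a ≠ 0) (hb : b ≠ 0) (hab : a ≠ b)
    (hab' : a ≠ -b) (h5 : Nat.card A ≠ 5) : (circulantGraph {a, b}).Colorable 4 := by
  have hgen' : ∀ v : A, ∃ i j : ℤ, i • b + j • a = v := fun v => by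
    obtain ⟨i, j, h⟩ := hgen v
    exact ⟨j, i, by rw [add_comm, h]⟩
  have hba' : b ≠ -a := fun h => hab' (by rw [h, neg_neg])
  by_cases hb2 : 2 • b = 0
  · exact circulantGraph_pair_colorable_four_of_eq_neg (two_nsmul_eq_zero_iff_eq_neg.1 hb2)
  by_cases ha2 : 2 • a = 0
  · rw [Set.pair_comm]
    exact circulantGraph_pair_colorable_four_of_eq_neg (two_nsmul_eq_zero_iff_eq_neg.1 ha2)
  have main : ∀ a b : A, (∀ v : A, ∃ i j : ℤ, i • a + j • b = v) → b ≠ 0 → 2 • b ≠ 0 →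
      a ∉ AddSubgroup.zmultiples b → (circulantGraph {a, b}).Colorable 4 := by
    intro a b hgen hb hb2 hm
    -- If `3 • b = 0`, then `b` and `-b` are adjacent and the deletion criterion is unavailable, but
    -- `b` has order 3.
    by_cases hb3 : 3 • b = 0
    · have : Fact (Nat.Prime 3) := ⟨Nat.prime_three⟩
      exact (circulantGraph_colorable_three_of_dvd_addOrderOf hgen
        (addOrderOf_eq_prime hb3 hb).symm.dvd hm).mono (by norm_num)
    · exact circulantGraph_pair_colorable_four_of_notMem hgen hm hb2 hb3
  by_cases hm : a ∈ AddSubgroup.zmultiples b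
  swap
  · exact main a b hgen hb hb2 hm
  by_cases hm' : b ∈ AddSubgroup.zmultiples a
  swap
  · rw [Set.pair_comm]
    exact main b a hgen' ha ha2 hm'
  have gen : ∀ a b : A, (∀ v : A, ∃ i j : ℤ, i • a + j • b = v) → a ∈ AddSubgroup.zmultiples b →
      ∀ v, v ∈ AddSubgroup.zmultiples b := by
    intro a b hgen hm v
    obtain ⟨i, j, rfl⟩ := hgen v
    exact add_mem (zsmul_mem hm i) (zsmul_mem (AddSubgroup.mem_zmultiples b) j)
  have gb := gen a b hgen hm
  have ga := gen b a hgen' hm'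
  have three : ∀ a b : A, a ≠ 0 → a ≠ b → a ≠ -b → (∀ v, v ∈ AddSubgroup.zmultiples b) →
      3 • b ≠ 0 := by
    intro a b ha hab hab' gb h
    obtain ⟨i, hi⟩ := AddSubgroup.mem_zmultiples_iff.1 (gb a)
    have h3 : (3 : ℤ) • b = 0 := (natCast_zsmul b 3).trans h
    have e : a = (i % 3) • b := by
      rw [← hi]
      conv_lhs => rw [← Int.emod_add_mul_ediv i 3, add_smul, mul_comm, mul_smul, h3]
      simp
    have : i % 3 = 0 ∨ i % 3 = 1 ∨ i % 3 = 2 := by omega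
    rcases this with h' | h' | h' <;> rw [h'] at e
    · exact ha (by simpa using e)
    · exact hab (by simpa using e)
    · refine hab' ?_
      rw [eq_neg_iff_add_eq_zero, e, ← h3, show (3 : ℤ) = 2 + 1 from rfl, add_smul, one_smul]
  have hb3 := three a b ha hab hab' gb
  have ha3 := three b a hb hab.symm hba' ga
  by_cases h1 : 2 • b ≠ a ∧ 2 • b ≠ -a
  · exact circulantGraph_pair_colorable_four_of_generator gb ha hab hab' hb2 hb3 h1.1 h1.2
  have five : 5 • b ≠ 0 := fun h => by
    have : Fact (Nat.Prime 5) := ⟨Nat.prime_five⟩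
    have h' := addOrderOf_eq_prime h hb
    rw [← Nat.card_zmultiples, (AddSubgroup.eq_top_iff' _).2 gb, AddSubgroup.card_top] at h'
    exact h5 h'
  have hdbl : ∀ c : A, c = 2 • b ∨ c = -(2 • b) → 2 • c ≠ b ∧ 2 • c ≠ -b := by
    rintro c (rfl | rfl)
    · refine ⟨fun h => hb3 ?_, fun h => five ?_⟩
      · rw [show 3 • b = 2 • 2 • b - b by abel, h, sub_self]
      · rw [show 5 • b = 2 • 2 • b + b by abel, h, neg_add_cancel]
    · refine ⟨fun h => five ?_, fun h => hb3 ?_⟩ <;> rw [smul_neg] at h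
      · rw [show 5 • b = 2 • 2 • b + b by abel]
        nth_rewrite 2 [← h]
        exact add_neg_cancel _
      · rw [show 3 • b = 2 • 2 • b - b by abel, neg_inj.1 h, sub_self]
  have h2 := hdbl a (by
    by_contra! h
    exact h1 ⟨h.1.symm, fun e => h.2 (by rw [e, neg_neg])⟩)
  rw [Set.pair_comm]
  exact circulantGraph_pair_colorable_four_of_generator ga hb hab.symm hba' ha2 ha3 h2.1 h2.2

theorem circulantGraph_pair_colorable_four [Finite A] (ha : a ≠ 0) (hb : b ≠ 0) (hab : a ≠ b)
    (hab' : a ≠ -b) (h5 : ¬ 5 ∣ Nat.card A) : (circulantGraph {a, b}).Colorable 4 := by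
  refine colorable_circulantGraph_of_closure (circulantGraph_pair_colorable_four_of_generates
    exists_zsmul_add_zsmul_eq_of_closure ?_ ?_ ?_ ?_ fun h =>
      h5 (h ▸ AddSubgroup.card_addSubgroup_dvd_card _))
  · simpa [Subtype.ext_iff] using ha
  · simpa [Subtype.ext_iff] using hb
  · simpa [Subtype.ext_iff] using hab
  · simpa [Subtype.ext_iff] using hab'

/-- A homomorphism-like coloring of a cyclic group by residues of the coefficient of a generator. -/
theorem circulantGraph_pair_colorable_of_generator {p : ℕ} [NeZero p] (hp : p ∣ addOrderOf b)
    (hp1 : p ≠ 1) (hgen : ∀ v : A, v ∈ AddSubgroup.zmultiples b) (i : ℤ) (hi : i • b = a)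
    (hpi : ¬ (p : ℤ) ∣ i) : (circulantGraph {a, b}).Colorable p := by
  choose I hI using fun v => AddSubgroup.mem_zmultiples_iff.1 (hgen v)
  have hval : ∀ j : ℤ, ((I (j • b) : ℤ) : ZMod p) = j := fun j => by
    rw [← sub_eq_zero, ← Int.cast_sub, ZMod.intCast_zmod_eq_zero_iff_dvd]
    refine (Int.natCast_dvd_natCast.2 hp).trans (addOrderOf_dvd_iff_zsmul_eq_zero.2 ?_)
    rw [sub_smul, hI, sub_self]
  have hstep : ∀ j : ℤ, ¬ (p : ℤ) ∣ j → ∀ v, ((I (v + j • b) : ℤ) : ZMod p) ≠ (I v : ZMod p) := by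
    intro j hj v h
    rw [← hI v, ← add_smul, hval, hI] at h
    refine hj ((ZMod.intCast_zmod_eq_zero_iff_dvd j p).1 ?_)
    push_cast at h
    linear_combination h
  have := colorable_circulantGraph_pair (a := a) (b := b) (C := ZMod p)
    (fun v => ((I v : ℤ) : ZMod p)) (fun v => ?_) fun v => ?_
  · simpa [ZMod.card] using this
  · rw [← hi]
    exact hstep i hpi v
  · have := hstep 1 (fun h => hp1 (by simpa using Int.natCast_dvd_natCast.1 h)) v
    rwa [one_smul] at this

theorem two_nsmul_eq_zero_of_dvd {u : ℕ} (hcard : Nat.card A ∣ 2 * 3 ^ u)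
    (h3 : ¬ 3 ∣ addOrderOf a) : 2 • a = 0 := by
  rw [← addOrderOf_dvd_iff_nsmul_eq_zero]
  refine Nat.Coprime.dvd_of_dvd_mul_right ?_ ((addOrderOf_dvd_natCard a).trans hcard)
  exact Nat.Coprime.pow_right _ ((Nat.prime_three.coprime_iff_not_dvd.2 h3).symm)

/-- If 3 divides neither order, both jumps are involutions and degrees are at most 2. If it divides
both and each jump generates, then `a = i • b` with `3 ∤ i`, and coefficients modulo 3 give a
coloring. If it divides one order only and that jump generates, parity of coefficients does.
Otherwise a jump of order divisible by 3 does not generate the other. -/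
theorem circulantGraph_pair_colorable_three_of_generates [Finite A]
    (hgen : ∀ v : A, ∃ i j : ℤ, i • a + j • b = v) (ha : a ≠ 0) (hb : b ≠ 0)
    {u : ℕ} (hcard : Nat.card A ∣ 2 * 3 ^ u) : (circulantGraph {a, b}).Colorable 3 := by
  have hgen' : ∀ v : A, ∃ i j : ℤ, i • b + j • a = v := fun v => by
    obtain ⟨i, j, h⟩ := hgen v
    exact ⟨j, i, by rw [add_comm, h]⟩
  have gen : ∀ a b : A, (∀ v : A, ∃ i j : ℤ, i • a + j • b = v) → a ∈ AddSubgroup.zmultiples b →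
      ∀ v, v ∈ AddSubgroup.zmultiples b := by
    intro a b hgen hm v
    obtain ⟨i, j, rfl⟩ := hgen v
    exact add_mem (zsmul_mem hm i) (zsmul_mem (AddSubgroup.mem_zmultiples b) j)
  have ord2 : ∀ a : A, a ≠ 0 → ¬ 3 ∣ addOrderOf a → addOrderOf a = 2 := by
    intro a ha h
    have : Fact (Nat.Prime 2) := ⟨Nat.prime_two⟩
    exact addOrderOf_eq_prime (two_nsmul_eq_zero_of_dvd hcard h) ha
  have mixed : ∀ a b : A, (∀ v : A, ∃ i j : ℤ, i • a + j • b = v) → a ≠ 0 → 3 ∣ addOrderOf b →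
      ¬ 3 ∣ addOrderOf a → (circulantGraph {a, b}).Colorable 3 := by
    intro a b hgen ha hb3 ha3
    by_cases hm : a ∈ AddSubgroup.zmultiples b
    swap
    · exact circulantGraph_colorable_three_of_dvd_addOrderOf hgen hb3 hm
    have gb := gen a b hgen hm
    have hordb : addOrderOf b = Nat.card A := by
      rw [← Nat.card_zmultiples, (AddSubgroup.eq_top_iff' _).2 gb, AddSubgroup.card_top]
    have h2 : 2 ∣ addOrderOf b := by
      rw [hordb, ← ord2 a ha ha3]
      exact addOrderOf_dvd_natCard a
    obtain ⟨i, hi⟩ := AddSubgroup.mem_zmultiples_iff.1 hm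
    refine (circulantGraph_pair_colorable_of_generator (p := 2) h2 (by norm_num) gb i hi
      ?_).mono (by norm_num)
    -- With `addOrderOf b = 2 * m` and `m` odd, `2 • a = 0` gives `2 * m ∣ 4 * s`, hence `m ∣ s` and
    -- `a = (2 * s) • b = 0`.
    rintro ⟨s, rfl⟩
    obtain ⟨m, hm'⟩ := h2
    have hodd : ¬ 2 ∣ m := by
      rintro ⟨l, rfl⟩
      have h4 : 2 * 2 ∣ 2 * 3 ^ u := by
        rw [← hordb, hm'] at hcard
        exact (Dvd.intro l (by ring)).trans hcard
      have := Nat.Prime.dvd_of_dvd_pow Nat.prime_two (Nat.dvd_of_mul_dvd_mul_left two_pos h4)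
      omega
    have e1 : (4 * s) • b = 0 := by
      have := two_nsmul_eq_zero_of_dvd hcard ha3
      rw [← hi, ← natCast_zsmul, ← mul_smul] at this
      rw [← this]
      congr 1
      push_cast
      ring
    have e2 : (2 * m : ℤ) ∣ 4 * s := by
      have := addOrderOf_dvd_iff_zsmul_eq_zero.2 e1
      rw [hm'] at this
      exact_mod_cast this
    have e3 : (m : ℤ) ∣ 2 * s := by
      obtain ⟨r, hr⟩ := e2
      exact ⟨r, by linarith⟩
    have e4 : (m : ℤ) ∣ s := by
      refine IsCoprime.dvd_of_dvd_mul_left ?_ e3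
      exact Nat.isCoprime_iff_coprime.2 (Nat.prime_two.coprime_iff_not_dvd.2 hodd).symm
    refine ha ?_
    rw [← hi, ← addOrderOf_dvd_iff_zsmul_eq_zero, hm']
    push_cast
    exact mul_dvd_mul_left 2 e4
  by_cases ha3 : 3 ∣ addOrderOf a
  swap
  · by_cases hb3 : 3 ∣ addOrderOf b
    · exact mixed a b hgen ha hb3 ha3
    · exact circulantGraph_pair_colorable_three_of_eq_neg
        (two_nsmul_eq_zero_iff_eq_neg.1 (two_nsmul_eq_zero_of_dvd hcard ha3))
        (two_nsmul_eq_zero_iff_eq_neg.1 (two_nsmul_eq_zero_of_dvd hcard hb3))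
  by_cases hb3 : 3 ∣ addOrderOf b
  swap
  · rw [Set.pair_comm]
    exact mixed b a hgen' hb ha3 hb3
  by_cases hm : a ∈ AddSubgroup.zmultiples b
  swap
  · exact circulantGraph_colorable_three_of_dvd_addOrderOf hgen hb3 hm
  by_cases hm' : b ∈ AddSubgroup.zmultiples a
  swap
  · rw [Set.pair_comm]
    exact circulantGraph_colorable_three_of_dvd_addOrderOf hgen' ha3 hm'
  obtain ⟨i, hi⟩ := AddSubgroup.mem_zmultiples_iff.1 hm
  obtain ⟨j, hj⟩ := AddSubgroup.mem_zmultiples_iff.1 hm'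
  refine circulantGraph_pair_colorable_of_generator hb3 (by norm_num) (gen a b hgen hm) i hi ?_
  intro h3i
  have e : (j * i - 1) • b = 0 := by
    rw [sub_smul, mul_smul, hi, hj, one_smul, sub_self]
  have h3 : (3 : ℤ) ∣ j * i - 1 :=
    (Int.natCast_dvd_natCast.2 hb3).trans (addOrderOf_dvd_iff_zsmul_eq_zero.2 e)
  have h3' : (3 : ℤ) ∣ j * i := h3i.mul_left j
  omega

theorem circulantGraph_pair_colorable_three [Finite A] (ha : a ≠ 0) (hb : b ≠ 0) {u : ℕ}
    (hcard : Nat.card A ∣ 2 * 3 ^ u) : (circulantGraph {a, b}).Colorable 3 := by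
  refine colorable_circulantGraph_of_closure (circulantGraph_pair_colorable_three_of_generates
    exists_zsmul_add_zsmul_eq_of_closure ?_ ?_
      ((AddSubgroup.card_addSubgroup_dvd_card _).trans hcard))
  · simpa [Subtype.ext_iff] using ha
  · simpa [Subtype.ext_iff] using hb

end SimpleGraph

/-! ### Distances in the cycle as residues modulo `n` -/

namespace SimpleGraph

variable {n : ℕ}

/-- `s` is the net displacement of the walk lifted to the integers, each edge contributing `±1`. -/
theorem exists_int_of_cycleGraph_walk {u v : Fin n} (p : (cycleGraph n).Walk u v) :
    ∃ s : ℤ, |s| ≤ p.length ∧ (n : ℤ) ∣ v - u - s := by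
  induction p with
  | nil => exact ⟨0, by simp, by simp⟩
  | @cons u w v h p ih =>
    obtain ⟨s, hs, hd⟩ := ih
    have key : ∀ x y : Fin n, (x - y).val = 1 → (n : ℤ) ∣ x - y - 1 := by
      intro x y hxy
      rw [Fin.val_sub] at hxy
      have hdm := Nat.div_add_mod (n - y.val + x.val) n
      rw [hxy] at hdm
      have hy := y.2
      refine ⟨((n - y.val + x.val) / n : ℕ) - 1, ?_⟩
      zify [hy.le] at hdm ⊢
      linarith
    rw [Walk.length_cons]
    push_cast
    rcases cycleGraph_adj'.1 h with h | h
    · refine ⟨s - 1, (abs_sub _ _).trans (by simpa using hs), ?_⟩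
      exact (dvd_sub hd (key _ _ h)).trans (dvd_of_eq (by ring))
    · refine ⟨s + 1, (abs_add_le _ _).trans (by simpa using hs), ?_⟩
      exact (dvd_add hd (key _ _ h)).trans (dvd_of_eq (by ring))

theorem cycleGraph_adj_of_val_eq (hn : 2 ≤ n) {u v : Fin n} (h : v.val = (u.val + 1) % n) :
    (cycleGraph n).Adj u v := by
  refine cycleGraph_adj'.2 (Or.inr ?_)
  rw [Fin.val_sub, h, Nat.add_mod_mod, show n - u.val + (u.val + 1) = 1 + n by omega,
    Nat.add_mod_right, Nat.mod_eq_of_lt (by omega)]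

theorem cycleGraph_connected_of_two_le (hn : 2 ≤ n) : (cycleGraph n).Connected := by
  obtain ⟨m, rfl⟩ := Nat.exists_eq_add_of_le' hn
  exact cycleGraph_connected

theorem cycleGraph_dist_le_of_val_eq (hn : 2 ≤ n) (k : ℕ) (u v : Fin n)
    (h : v.val = (u.val + k) % n) : (cycleGraph n).dist u v ≤ k := by
  induction k generalizing v with
  | zero =>
    obtain rfl : v = u := Fin.ext (by rw [h, add_zero, Nat.mod_eq_of_lt u.2])
    simp
  | succ k ih =>
    let w : Fin n := ⟨(u.val + k) % n, Nat.mod_lt _ (by omega)⟩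
    have hwv : (cycleGraph n).Adj w v := cycleGraph_adj_of_val_eq hn (by
      rw [h]; simp [w, add_assoc])
    have := (cycleGraph_connected_of_two_le hn).dist_triangle (u := u) (v := w) (w := v)
    rw [dist_eq_one_iff_adj.2 hwv] at this
    exact this.trans (Nat.add_le_add_right (ih w rfl) 1)

theorem cycleGraph_dist_le_natAbs (hn : 2 ≤ n) {u v : Fin n} {s : ℤ}
    (h : (n : ℤ) ∣ v - u - s) : (cycleGraph n).dist u v ≤ s.natAbs := by
  have key : ∀ (x y : Fin n) (k : ℕ), (n : ℤ) ∣ y - x - k → (cycleGraph n).dist x y ≤ k := by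
    intro x y k hk
    refine cycleGraph_dist_le_of_val_eq hn k x y ?_
    have : (x.val + k) ≡ y.val [MOD n] := by
      rw [← Int.natCast_modEq_iff]
      refine (Int.modEq_iff_dvd).2 ?_
      push_cast
      rwa [← sub_sub]
    rw [this, Nat.mod_eq_of_lt y.2]
  rcases Int.natAbs_eq s with hs | hs
  · exact key u v _ (by rwa [← hs])
  · rw [dist_comm]
    refine key v u _ ?_
    rw [hs] at h
    exact ((dvd_neg (α := ℤ)).2 h).trans (dvd_of_eq (by ring))

theorem two_mul_cycleGraph_dist_le (hn : 2 ≤ n) (u v : Fin n) :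
    2 * (cycleGraph n).dist u v ≤ n := by
  have h1 : (cycleGraph n).dist u v ≤ ((v : ℤ) - u).natAbs :=
    cycleGraph_dist_le_natAbs hn (by simp)
  have h2 : (cycleGraph n).dist u v ≤ ((v : ℤ) - u - n).natAbs :=
    cycleGraph_dist_le_natAbs hn (by simp)
  have h3 : (cycleGraph n).dist u v ≤ ((v : ℤ) - u + n).natAbs :=
    cycleGraph_dist_le_natAbs hn (by simp)
  have hu := u.2
  have hv := v.2
  omega

/-- A shortest walk has displacement `s` with `|s|` equal to the distance. A displacement with `|s|
< d` satisfies `|s ± d| < 2 * d ≤ n`, so it is not congruent to `±d`. -/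
theorem cycleGraph_dist_eq_iff (hn : 2 ≤ n) {u v : Fin n} {d : ℕ} (hd : 2 * d ≤ n) :
    (cycleGraph n).dist u v = d ↔ (n : ℤ) ∣ v - u - d ∨ (n : ℤ) ∣ v - u + d := by
  obtain ⟨p, hp⟩ := (cycleGraph_connected_of_two_le hn).exists_walk_length_eq_dist u v
  obtain ⟨s, hs, hsd⟩ := exists_int_of_cycleGraph_walk p
  have hle := cycleGraph_dist_le_natAbs hn hsd
  rw [hp] at hs
  have habs : (s.natAbs : ℤ) = |s| := Int.natCast_natAbs s
  constructor
  · intro h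
    have : s.natAbs = d := by omega
    rcases Int.natAbs_eq s with h' | h' <;> rw [this] at h' <;> rw [h'] at hsd
    · exact Or.inl hsd
    · exact Or.inr (by simpa using hsd)
  · intro h
    have h1 : (cycleGraph n).dist u v ≤ d := by
      rcases h with h | h
      · simpa using cycleGraph_dist_le_natAbs hn h
      · simpa using cycleGraph_dist_le_natAbs hn (s := -d) (by simpa using h)
    refine le_antisymm h1 ?_
    by_contra! hlt
    have hsd' : (n : ℤ) ∣ s - d ∨ (n : ℤ) ∣ s + d := by
      rcases h with h | h
      · left
        exact (dvd_sub h hsd).trans (dvd_of_eq (by ring))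
      · right
        exact (dvd_sub h hsd).trans (dvd_of_eq (by ring))
    have hs2 := abs_le.1 hs
    rcases hsd' with h' | h'
    · have := Int.eq_zero_of_abs_lt_dvd h' (abs_lt.2 ⟨by omega, by omega⟩)
      omega
    · have := Int.eq_zero_of_abs_lt_dvd h' (abs_lt.2 ⟨by omega, by omega⟩)
      omega

theorem mem_realizedDistances_cycleGraph (hn : 2 ≤ n) {d : ℕ} :
    d ∈ (cycleGraph n).realizedDistances ↔ 1 ≤ d ∧ 2 * d ≤ n := by
  constructor
  · rintro ⟨h0, u, v, rfl⟩
    exact ⟨Nat.one_le_iff_ne_zero.2 h0, two_mul_cycleGraph_dist_le hn u v⟩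
  · rintro ⟨h1, h2⟩
    refine ⟨by omega, ⟨0, by omega⟩, ⟨d, by omega⟩, (cycleGraph_dist_eq_iff hn h2).2 (Or.inl ?_)⟩
    simp

theorem distanceGraph_cycleGraph_pair_adj (hn : 2 ≤ n) {d e : ℕ} (hd : 1 ≤ d) (hd' : 2 * d ≤ n)
    (he : 1 ≤ e) (he' : 2 * e ≤ n) {u v : Fin n} :
    ((cycleGraph n).distanceGraph (({d, e} : Finset ℕ) : Set ℕ)).Adj u v ↔
      ((n : ℤ) ∣ v - u - d ∨ (n : ℤ) ∣ v - u + d) ∨ (n : ℤ) ∣ v - u - e ∨ (n : ℤ) ∣ v - u + e := by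
  rw [← cycleGraph_dist_eq_iff hn hd', ← cycleGraph_dist_eq_iff hn he']
  simp only [distanceGraph, Finset.coe_insert, Finset.coe_singleton, Set.mem_insert_iff,
    Set.mem_singleton_iff]
  omega

theorem natCast_zmod_ne_zero_of_le {d : ℕ} (hd : 1 ≤ d) (hd' : 2 * d ≤ n) :
    (d : ZMod n) ≠ 0 := by
  rw [Ne, ZMod.natCast_eq_zero_iff]
  intro h
  have := Nat.le_of_dvd hd h
  omega

/-- A distance graph of a cycle for two distances maps to a circulant graph with two jumps. -/
theorem distanceGraph_cycleGraph_colorable (hn : 2 ≤ n) {k d e : ℕ} (hd : 1 ≤ d)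
    (hd' : 2 * d ≤ n) (he : 1 ≤ e) (he' : 2 * e ≤ n)
    (h : (circulantGraph {(d : ZMod n), (e : ZMod n)}).Colorable k) :
    ((cycleGraph n).distanceGraph (({d, e} : Finset ℕ) : Set ℕ)).Colorable k := by
  refine h.of_hom (⟨fun u => ((u.val : ℤ) : ZMod n), ?_⟩ : _ →g circulantGraph _)
  intro u v huv
  have hne : u ≠ v := huv.ne
  rw [distanceGraph_cycleGraph_pair_adj hn hd hd' he he'] at huv
  refine circulantGraph_pair_adj.2 ⟨fun h' => hne ?_, ?_⟩
  · rw [ZMod.intCast_eq_intCast_iff] at h'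
    have h' := (Int.natCast_modEq_iff).1 h'
    rw [Nat.ModEq, Nat.mod_eq_of_lt u.2, Nat.mod_eq_of_lt v.2] at h'
    exact Fin.ext h'
  · simp only [← ZMod.intCast_zmod_eq_zero_iff_dvd] at huv
    push_cast at huv ⊢
    rcases huv with (h | h) | h | h
    · left; linear_combination h
    · right; left; linear_combination h
    · right; right; left; linear_combination h
    · right; right; right; linear_combination h

/-! ### Upper and lower bounds for the second Babai number -/

theorem babaiNumber_two_cycleGraph_le (hn : 2 ≤ n) {k : ℕ}
    (h : ∀ d e : ℕ, 1 ≤ d → d < e → 2 * e ≤ n →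
      (circulantGraph {(d : ZMod n), (e : ZMod n)}).Colorable k) :
    babaiNumber 2 (cycleGraph n) ≤ k := by
  refine sSup_le ?_
  rintro c ⟨D, hD, hcard, rfl⟩
  obtain ⟨d, e, hne, rfl⟩ := Finset.card_eq_two.1 hcard
  have hd := (mem_realizedDistances_cycleGraph hn).1 (hD (by simp : d ∈ _))
  have he := (mem_realizedDistances_cycleGraph hn).1 (hD (by simp : e ∈ _))
  refine (distanceGraph_cycleGraph_colorable hn hd.1 hd.2 he.1 he.2 ?_).chromaticNumber_le
  rcases lt_or_gt_of_ne hne with hlt | hlt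
  · exact h d e hd.1 hlt he.2
  · rw [Set.pair_comm]
    exact h e d he.1 hlt hd.2

theorem le_babaiNumber_two_cycleGraph (hn : 2 ≤ n) {d e : ℕ} (hd : 1 ≤ d)
    (hd' : 2 * d ≤ n) (he : 1 ≤ e) (he' : 2 * e ≤ n) (hne : d ≠ e) {k : ℕ∞}
    (h : k ≤ ((cycleGraph n).distanceGraph (({d, e} : Finset ℕ) : Set ℕ)).chromaticNumber) :
    k ≤ babaiNumber 2 (cycleGraph n) := by
  refine h.trans (le_sSup ⟨{d, e}, ?_, Finset.card_pair hne, rfl⟩)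
  intro x hx
  simp only [Finset.coe_insert, Finset.coe_singleton, Set.mem_insert_iff,
    Set.mem_singleton_iff] at hx
  rcases hx with rfl | rfl
  · exact (mem_realizedDistances_cycleGraph hn).2 ⟨hd, hd'⟩
  · exact (mem_realizedDistances_cycleGraph hn).2 ⟨he, he'⟩

theorem babaiNumber_two_cycleGraph_le_five (hn : 2 ≤ n) : babaiNumber 2 (cycleGraph n) ≤ 5 := by
  have : NeZero n := ⟨by omega⟩
  exact babaiNumber_two_cycleGraph_le hn fun d e _ _ _ => circulantGraph_pair_colorable_five

theorem babaiNumber_two_cycleGraph_le_four (hn : 2 ≤ n) (h5 : ¬ 5 ∣ n) :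
    babaiNumber 2 (cycleGraph n) ≤ 4 := by
  have : NeZero n := ⟨by omega⟩
  refine babaiNumber_two_cycleGraph_le hn fun d e hd hde he => circulantGraph_pair_colorable_four
    (natCast_zmod_ne_zero_of_le hd (by omega))
    (natCast_zmod_ne_zero_of_le (by omega) he) (fun h => ?_) (fun h => ?_) (by simpa using h5)
  · rw [ZMod.natCast_eq_natCast_iff, Nat.ModEq, Nat.mod_eq_of_lt (by omega),
      Nat.mod_eq_of_lt (by omega)] at h
    omega
  · rw [eq_neg_iff_add_eq_zero, ← Nat.cast_add, ZMod.natCast_eq_zero_iff] at h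
    have := Nat.le_of_dvd (by omega) h
    omega

theorem babaiNumber_two_cycleGraph_le_three (hn : 2 ≤ n) {u : ℕ} (h : n ∣ 2 * 3 ^ u) :
    babaiNumber 2 (cycleGraph n) ≤ 3 := by
  have : NeZero n := ⟨by omega⟩
  exact babaiNumber_two_cycleGraph_le hn fun d e hd hde he => circulantGraph_pair_colorable_three
    (natCast_zmod_ne_zero_of_le hd (by omega))
    (natCast_zmod_ne_zero_of_le (by omega) he) (u := u) (by simpa using h)

/-- The multiples of `n / 5` form a `K₅`, because nonzero residues modulo 5 are `±1` or `±2`. -/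
theorem five_le_babaiNumber_two_cycleGraph (hn : 2 ≤ n) (h5 : 5 ∣ n) :
    5 ≤ babaiNumber 2 (cycleGraph n) := by
  obtain ⟨m, rfl⟩ := h5
  have hm : 1 ≤ m := by omega
  refine le_babaiNumber_two_cycleGraph hn (d := m) (e := 2 * m) hm (by omega) (by omega) (by omega)
    (by omega) ?_
  refine le_chromaticNumber_of_pairwise_adj (n := 5) (ι := Fin 5) (by simp)
    (fun i => ⟨i.val * m, by have := Nat.mul_lt_mul_of_pos_right i.2 hm; omega⟩) ?_
  intro i j hij
  rw [distanceGraph_cycleGraph_pair_adj hn hm (by omega) (by omega) (by omega)]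
  push_cast
  have key : ∀ i j : Fin 5, i ≠ j → ∃ r : ℤ, (j : ℤ) - i - 1 = 5 * r ∨ (j : ℤ) - i + 1 = 5 * r ∨
      (j : ℤ) - i - 2 = 5 * r ∨ (j : ℤ) - i + 2 = 5 * r := by
    intro i j hij
    have : i.val ≠ j.val := fun h => hij (Fin.ext h)
    have hi := i.2
    have hj := j.2
    by_cases h1 : (j : ℤ) - i = 4
    · exact ⟨1, by omega⟩
    by_cases h2 : (j : ℤ) - i = 3
    · exact ⟨1, by omega⟩
    by_cases h3 : (j : ℤ) - i = -3
    · exact ⟨-1, by omega⟩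
    by_cases h4 : (j : ℤ) - i = -4
    · exact ⟨-1, by omega⟩
    exact ⟨0, by omega⟩
  obtain ⟨r, h | h | h | h⟩ := key i j hij
  · exact Or.inl (Or.inl ⟨r, by linear_combination (m : ℤ) * h⟩)
  · exact Or.inl (Or.inr ⟨r, by linear_combination (m : ℤ) * h⟩)
  · exact Or.inr (Or.inl ⟨r, by linear_combination (m : ℤ) * h⟩)
  · exact Or.inr (Or.inr ⟨r, by linear_combination (m : ℤ) * h⟩)

/-- The distance `n / 3` alone gives a triangle; the distance 1 only fills up `D`, and differs from
`n / 3` because `n ≥ 4`. -/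
theorem three_le_babaiNumber_two_cycleGraph (hn : 4 ≤ n) (h3 : 3 ∣ n) :
    3 ≤ babaiNumber 2 (cycleGraph n) := by
  obtain ⟨m, rfl⟩ := h3
  have hm : 2 ≤ m := by omega
  refine le_babaiNumber_two_cycleGraph (by omega) (d := m) (e := 1) (by omega) (by omega) le_rfl
    (by omega) (by omega) ?_
  refine le_chromaticNumber_of_pairwise_adj (n := 3) (ι := Fin 3) (by simp)
    (fun i => ⟨i.val * m, by
      have := Nat.mul_lt_mul_of_pos_right i.2 (by omega : 0 < m); omega⟩) ?_
  intro i j hij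
  rw [distanceGraph_cycleGraph_pair_adj (by omega) (by omega) (by omega) le_rfl
    (by omega)]
  push_cast
  left
  have key : ∃ r : ℤ, (j : ℤ) - i - 1 = 3 * r ∨ (j : ℤ) - i + 1 = 3 * r := by
    have : i.val ≠ j.val := fun h => hij (Fin.ext h)
    have hi := i.2
    have hj := j.2
    by_cases h1 : (j : ℤ) - i = 2
    · exact ⟨1, by omega⟩
    by_cases h2 : (j : ℤ) - i = -2
    · exact ⟨-1, by omega⟩
    exact ⟨0, by omega⟩
  obtain ⟨r, h | h⟩ := key
  · exact Or.inl ⟨r, by linear_combination (m : ℤ) * h⟩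
  · exact Or.inr ⟨r, by linear_combination (m : ℤ) * h⟩

/-- A sequence of three colors in which any three consecutive terms are distinct has period `3`. -/
theorem eq_of_forall_ne_three {g : ℕ → Fin 3} (h1 : ∀ i, g (i + 1) ≠ g i)
    (h2 : ∀ i, g (i + 2) ≠ g i) (q r : ℕ) : g (r + 3 * q) = g r := by
  -- Both are the one color missing from `g (i + 1)` and `g (i + 2)`.
  have h3 : ∀ i, g (i + 3) = g i := fun i => by
    have a1 := h1 i
    have a2 := h1 (i + 1)
    have a3 := h1 (i + 2)
    have a4 := h2 i
    have a5 := h2 (i + 1)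
    simp only [add_assoc, Nat.reduceAdd] at a2 a3 a5
    generalize g i = x at *
    generalize g (i + 1) = y at *
    generalize g (i + 2) = z at *
    generalize g (i + 3) = w at *
    omega
  induction q with
  | zero => rfl
  | succ q ih => rw [Nat.mul_succ, ← add_assoc, h3, ih]

/-- The multiples of `d` carry the square of a `w`-cycle, and `4 ≤ w` makes `2 * d` a realized
distance. A 3-coloring would have period 3 along it, so returning to the start after `w` steps gives
`0` the color of its neighbor `w % 3`. -/
theorem four_le_babaiNumber_two_cycleGraph {d w : ℕ} (hd : 1 ≤ d) (hw : 4 ≤ w) (h3 : ¬ 3 ∣ w) :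
    4 ≤ babaiNumber 2 (cycleGraph (d * w)) := by
  have hdw : 4 * d ≤ d * w := by rw [mul_comm 4 d]; exact Nat.mul_le_mul_left d hw
  set n := d * w with hn
  have hn2 : 2 ≤ n := by omega
  refine le_babaiNumber_two_cycleGraph hn2 (d := d) (e := 2 * d) hd (by omega) (by omega)
    (by omega) (by omega) ?_
  refine le_chromaticNumber_iff_colorable.2 fun m hm => ?_
  by_contra! hlt
  obtain ⟨C⟩ := hm.mono (Nat.le_of_lt_succ hlt)
  let p : ℕ → Fin n := fun i => ⟨(i * d) % n, Nat.mod_lt _ (by omega)⟩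
  have hp : ∀ i : ℕ, ∃ t : ℤ, ((p i : ℕ) : ℤ) = i * d - n * t := fun i =>
    ⟨((i * d) / n : ℕ), by
      have := Nat.div_add_mod (i * d) n
      simp only [p]
      zify at this ⊢
      linarith⟩
  have h1 : ∀ i, C (p (i + 1)) ≠ C (p i) := fun i => by
    refine (C.valid ?_).symm
    rw [distanceGraph_cycleGraph_pair_adj hn2 hd (by omega) (by omega) (by omega)]
    obtain ⟨t, ht⟩ := hp i
    obtain ⟨t', ht'⟩ := hp (i + 1)
    left; left
    exact ⟨t - t', by rw [ht, ht']; push_cast; ring⟩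
  have h2 : ∀ i, C (p (i + 2)) ≠ C (p i) := fun i => by
    refine (C.valid ?_).symm
    rw [distanceGraph_cycleGraph_pair_adj hn2 hd (by omega) (by omega) (by omega)]
    obtain ⟨t, ht⟩ := hp i
    obtain ⟨t', ht'⟩ := hp (i + 2)
    right; left
    exact ⟨t - t', by rw [ht, ht']; push_cast; ring⟩
  have hper := eq_of_forall_ne_three (g := fun i => C (p i)) h1 h2
  have hw0 : p w = p 0 := by
    simp only [p]
    rw [mul_comm w d, ← hn]
    simp
  have hr : w = 1 + 3 * (w / 3) ∨ w = 2 + 3 * (w / 3) := by omega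
  rcases hr with hr | hr
  · have := hper (w / 3) 1
    rw [← hr] at this
    simp only [hw0] at this
    exact h1 0 this.symm
  · have := hper (w / 3) 2
    rw [← hr] at this
    simp only [hw0] at this
    exact h2 0 this.symm

end SimpleGraph

theorem theorem3p3p5 (n : ℕ) (hn : 4 ≤ n) :
    ((∃ u : ℕ, 0 < u ∧ (n = 3 ^ u ∨ n = 2 * 3 ^ u)) →
      SimpleGraph.babaiNumber 2 (SimpleGraph.cycleGraph n) = 3) ∧
    ((¬ ∃ u : ℕ, 0 < u ∧ (n = 3 ^ u ∨ n = 2 * 3 ^ u)) → ¬ 5 ∣ n →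
      SimpleGraph.babaiNumber 2 (SimpleGraph.cycleGraph n) = 4) ∧
    (5 ∣ n → SimpleGraph.babaiNumber 2 (SimpleGraph.cycleGraph n) = 5) := by
  have hn2 : 2 ≤ n := by omega
  refine ⟨?_, ?_, ?_⟩
  · rintro ⟨u, hu, h⟩
    have h3u : 3 ∣ 3 ^ u := dvd_pow_self 3 hu.ne'
    refine le_antisymm (SimpleGraph.babaiNumber_two_cycleGraph_le_three hn2 (u := u) ?_)
      (SimpleGraph.three_le_babaiNumber_two_cycleGraph hn ?_)
    · rcases h with rfl | rfl
      · exact Dvd.intro_left 2 rfl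
      · exact dvd_rfl
    · rcases h with rfl | rfl
      · exact h3u
      · exact h3u.mul_left 2
  · intro h h5
    refine le_antisymm (SimpleGraph.babaiNumber_two_cycleGraph_le_four hn2 h5) ?_
    obtain ⟨u, w, hw, rfl⟩ := Nat.exists_eq_pow_mul_and_not_dvd (by omega : n ≠ 0) 3 (by norm_num)
    refine SimpleGraph.four_le_babaiNumber_two_cycleGraph (Nat.pos_of_ne_zero (by simp)) ?_ hw
    -- For `w < 4`, `n ≥ 4` forces `u > 0`; `w = 1` and `w = 2` are the excluded shapes, and 3
    -- divides 0 and 3.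
    by_contra! hlt
    have hu : 0 < u := by
      rcases Nat.eq_zero_or_pos u with rfl | hu
      · simp at hn
        omega
      · exact hu
    interval_cases w
    · simp at hw
    · exact h ⟨u, hu, Or.inl (by ring)⟩
    · exact h ⟨u, hu, Or.inr (by ring)⟩
    · simp at hw
  · intro h5
    exact le_antisymm (SimpleGraph.babaiNumber_two_cycleGraph_le_five hn2)
      (SimpleGraph.five_le_babaiNumber_two_cycleGraph hn2 h5)
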